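/- For a real matrix, its column sparsity is the maximum number of nonzero entries in a column. For $\epsilon,\delta>0$ and a random matrix $A\in\mathbb{R}^{n\times d}$ with distribution $\mathcal{D}$, a fixed matrix $\Pi\in\mathbb{R}^{m\times n}$ is called an $(\epsilon,\delta)$-subspace-embedding for $A\sim\mathcal{D}$ if \[ \Pr_{A\sim\mathcal{D}}\left\{\forall x\in\mathbb{R}^d,\ (1-\epsilon)\|Ax\|_2\le\|\Pi Ax\|_2\le(1+\epsilon)\|Ax\|_2\right\}\ge 1-\delta . \] For $\beta\in(0,1]$ with $1/\beta$ an integer, let $\mathcal{D}_\beta$ be the distribution of $U=VW\in\mathbb{R}^{n\times d}$, where $V\in\mathbb{R}^{n\times d/\beta}$ has i.i.d. columns, each uniformly distributed among the $n$ canonical basis vectors of $\mathbb{R}^n$, and $W\in\mathbb{R}^{d/\beta\times d}$ has the entries $W_{j,i}=\sigma_j\sqrt{\beta}$ for $(i-1)/\beta+1\le j\le i/\beta$ and $W_{j,i}=0$ otherwise, with independent Rademacher signs $\sigma_j\in\{-1,1\}$ that are independent of $V$. For $0<\epsilon\le 1/16$ let $L=\lfloor\log_2(1/\epsilon)-3\rfloor\ge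 1$, and let $\widetilde{\mathcal{D}}$ be the distribution on $\mathbb{R}^{n\times d}$ that is $\mathcal{D}_1$ with probability $1/2$ and, with probability $1/2$, is $\mathcal{D}_{2^{-\ell}}$ for $\ell$ chosen uniformly at random in $\{1,\dots,L\}$. There exist absolute constants $\epsilon_0,\delta_0,c_0,K_0,K_1>0$ with $\epsilon_0\le 1/16$ such that the following holds. For all $\epsilon\in(0,\epsilon_0)$ and $\delta\in(0,\delta_0)$, all integers $d\ge 1/\epsilon^2$ and $n\ge K_0d^2/(\epsilon^2\delta)$, and all $m$: if $\Pi\in\mathbb{R}^{m\times n}$ has column sparsity at most $1/(9\epsilon)$ and is an $(\epsilon,\delta)$-subspace-embedding for $U\sim\widetilde{\mathcal{D}}$, then \[ m> c_0\,\bigl(\log_2(1/\epsilon)\bigr)^{-4}\,\epsilon^{K_1\delta}\,d^2 . \] -/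

import Mathlib

namespace SparseEmbedding

noncomputable section

/-- The column sparsity of a matrix: the maximum number of nonzero entries in a column. -/
def colSparsity {m n : ℕ} (P : Matrix (Fin m) (Fin n) ℝ) : ℕ :=
  Finset.univ.sup fun j : Fin n => (Finset.univ.filter fun i : Fin m => P i j ≠ 0).card

/-- The Euclidean norm of a real vector. -/
def l2norm {k : ℕ} (v : Fin k → ℝ) : ℝ := ‖WithLp.toLp 2 v‖

/-- `P` is a subspace embedding (with distortion `ε`) for the fixed matrix `A`:
`(1 - ε) ‖A x‖₂ ≤ ‖P A x‖₂ ≤ (1 + ε) ‖A x‖₂` for all `x`. -/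
def Embeds {m n d : ℕ} (ε : ℝ) (P : Matrix (Fin m) (Fin n) ℝ)
    (A : Matrix (Fin n) (Fin d) ℝ) : Prop :=
  ∀ x : Fin d → ℝ,
    (1 - ε) * l2norm (A.mulVec x) ≤ l2norm ((P * A).mulVec x) ∧
    l2norm ((P * A).mulVec x) ≤ (1 + ε) * l2norm (A.mulVec x)

/-- `P` is an `(ε, δ)`-subspace-embedding for a random matrix `A ∼ D`. -/
def IsSubspaceEmbedding {m n d : ℕ} (ε δ : ℝ) (P : Matrix (Fin m) (Fin n) ℝ)
    (D : PMF (Matrix (Fin n) (Fin d) ℝ)) : Prop :=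
  ENNReal.ofReal (1 - δ) ≤ D.toOuterMeasure {A | Embeds ε P A}

/-- The matrix whose column `j` is the canonical basis vector with index `c j`. The column
index `(i, t)` stands for the position of the `t`-th element of the `i`-th block. -/
def selMatrix {n d k : ℕ} (c : Fin d × Fin k → Fin n) :
    Matrix (Fin n) (Fin d × Fin k) ℝ :=
  Matrix.of fun r j => if r = c j then 1 else 0

/-- The block matrix with entries `σ j * √β`, `β = 1 / k`, for `j` in the `i`-th block of `k`
consecutive rows, and zero elsewhere. -/
def signMatrix {d k : ℕ} (σ : Fin d × Fin k → ℤˣ) :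
    Matrix (Fin d × Fin k) (Fin d) ℝ :=
  Matrix.of fun j i => if j.1 = i then (((σ j : ℤˣ) : ℤ) : ℝ) * √(1 / (k : ℝ)) else 0

/-- The distribution `D_β` on `n × d` matrices for `β = 1 / k`: the law of `U = V W`, where the
`d k` columns of `V` are i.i.d. uniform canonical basis vectors and the signs in `W` are
independent Rademacher variables, independent of `V`. -/
def hardDist (n d k : ℕ) [NeZero n] : PMF (Matrix (Fin n) (Fin d) ℝ) :=
  (PMF.uniformOfFintype ((Fin d × Fin k → Fin n) × (Fin d × Fin k → ℤˣ))).map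
    fun ω => selMatrix ω.1 * signMatrix ω.2

/-- The number of levels, the integer part of `log₂ (1 / ε) - 3`. -/
def levels (ε : ℝ) : ℕ := ⌊Real.logb 2 (1 / ε) - 3⌋₊

open Classical in
/-- The mixed distribution: with probability `1/2` it is `D_1`; with probability `1/2` it is
`D_{2^{-ℓ}}` for `ℓ` uniform in `{1, …, L}`, where `L = levels ε`. The default value `D_1` in
the second branch is only used when `{1, …, L}` is empty, i.e. when `ε > 1 / 16`. -/
def mixedDist (ε : ℝ) (n d : ℕ) [NeZero n] : PMF (Matrix (Fin n) (Fin d) ℝ) :=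
  (PMF.uniformOfFintype Bool).bind fun b =>
    if b then hardDist n d 1
    else if h : (Finset.Icc 1 (levels ε)).Nonempty then
      (PMF.uniformOfFinset (Finset.Icc 1 (levels ε)) h).bind fun l => hardDist n d (2 ^ l)
    else hardDist n d 1

end

end SparseEmbedding

/-! Only the `D_1` half of the mixture is needed, and it gives the stronger bound `d ^ 2 ≤ 6912 * m`
(`sq_le_rows`): two opposite estimates of how often a random pair of columns of `P` is coherent,
i.e. has inner product exceeding `2 * ε` in absolute value.

Upper estimate: under `D_1` an embedding forces the sampled columns to have norm near one and
distinct ones to be incoherent. Coherent pairs are thus rarely seen between the two halves of a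
sample of size `d`. Once the columns of high degree in the coherence graph are removed, a
second-moment argument (`exists_sparse_subset`) bounds the density of coherent pairs by order `1 / d
^ 2`.

Lower estimate (`coherent_pairs_lower_bound`): sparsity `1 / (9 * ε)` forces a constant share of
each column's mass onto entries of square at least `8 * ε`. In dimension `m` such heavy parts must
overlap, so the density is at least of order `1 / m`. -/

open scoped BigOperators

namespace SparseEmbedding

/-! ### Independent uniform samples and the second moment of edge counts -/

section Sampling

variable {ι κ α : Type*} [Fintype ι] [Fintype κ] [Fintype α]

/-- The expectation of a product of functions of independent uniform coordinates. -/
theorem expect_pi_prod [DecidableEq ι] (f : ι → α → ℝ) :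
    𝔼 x : ι → α, ∏ i, f i (x i) = ∏ i, 𝔼 a, f i a := by
  simp only [Fintype.expect_eq_sum_div_card, Finset.prod_div_distrib, Fintype.prod_sum]
  simp

theorem expect_pi_apply [DecidableEq ι] [Nonempty α] (g : α → ℝ) (i : ι) :
    𝔼 x : ι → α, g (x i) = 𝔼 a, g a := by
  have h := expect_pi_prod (fun j : ι => if j = i then g else fun _ : α => 1)
  have h1 (x : ι → α) :
      ∏ j, (if j = i then g else fun _ => 1) (x j) = g (x i) := by
    rw [Finset.prod_eq_single i] <;> simp +contextual
  have h2 : ∏ j, 𝔼 a, (if j = i then g else fun _ => 1) a = 𝔼 a, g a := by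
    rw [Finset.prod_eq_single i] <;> simp +contextual
  simpa only [h1, h2] using h

theorem expect_pi_apply_mul [DecidableEq ι] [Nonempty α] (g : α → ℝ) {i j : ι} (hij : i ≠ j) :
    𝔼 x : ι → α, g (x i) * g (x j) = (𝔼 a, g a) ^ 2 := by
  have h := expect_pi_prod (fun k : ι => if k = i ∨ k = j then g else fun _ : α => 1)
  have h1 (x : ι → α) :
      ∏ k, (if k = i ∨ k = j then g else fun _ => 1) (x k) = g (x i) * g (x j) := by
    rw [Finset.prod_eq_mul i j hij] <;> simp +contextual
  have h2 : ∏ k, 𝔼 a, (if k = i ∨ k = j then g else fun _ => 1) a = (𝔼 a, g a) ^ 2 := by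
    rw [Finset.prod_eq_mul i j hij, sq] <;> simp +contextual
  simpa only [h1, h2] using h

theorem expect_sum_apply [DecidableEq ι] [Nonempty α] (g : α → ℝ) :
    𝔼 x : ι → α, ∑ i, g (x i) = Fintype.card ι * 𝔼 a, g a := by
  rw [Finset.expect_sum_comm]
  simp [expect_pi_apply]

/-- Off-diagonal terms factor by independence. The last term counts all pairs, diagonal included,
which only weakens the bound. -/
theorem expect_sq_sum_apply_le [DecidableEq ι] [Nonempty α] (g : α → ℝ) :
    𝔼 x : ι → α, (∑ i, g (x i)) ^ 2 ≤
      Fintype.card ι * 𝔼 a, g a ^ 2 + Fintype.card ι ^ 2 * (𝔼 a, g a) ^ 2 := by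
  have hterm (i j : ι) : 𝔼 x : ι → α, g (x i) * g (x j) ≤
      (if i = j then 𝔼 a, g a ^ 2 else 0) + (𝔼 a, g a) ^ 2 := by
    by_cases hij : i = j
    · subst hij
      have := expect_pi_apply (fun a => g a ^ 2) i
      simp only [← sq, this, if_true]
      linarith [sq_nonneg (𝔼 a, g a)]
    · simp [hij, expect_pi_apply_mul g hij]
  calc 𝔼 x : ι → α, (∑ i, g (x i)) ^ 2
      = ∑ i, ∑ j, 𝔼 x : ι → α, g (x i) * g (x j) := by
        simp only [sq, Finset.sum_mul_sum, Finset.expect_sum_comm]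
    _ ≤ ∑ i : ι, ∑ j, ((if i = j then 𝔼 a, g a ^ 2 else 0) + (𝔼 a, g a) ^ 2) :=
        Finset.sum_le_sum fun i _ => Finset.sum_le_sum fun j _ => hterm i j
    _ = _ := by
        simp only [Finset.sum_add_distrib, Finset.sum_ite_eq, Finset.mem_univ, if_true,
          Finset.sum_const, Finset.card_univ, nsmul_eq_mul]
        ring

/-- Second moment of the number of edges between two independent samples, for a symmetric
0-1 kernel with bounded degrees. -/
theorem expect_sq_edges_le [DecidableEq ι] [DecidableEq κ] [Nonempty α] (e : α → α → ℝ)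
    (he : ∀ a b, e a b ^ 2 = e a b) (hsymm : ∀ a b, e a b = e b a) {D : ℝ}
    (hD : ∀ a, 𝔼 b, e a b ≤ D) :
    𝔼 x : ι → α, 𝔼 y : κ → α, (∑ i, ∑ j, e (x i) (y j)) ^ 2 ≤
      Fintype.card ι * Fintype.card κ * (𝔼 a, 𝔼 b, e a b) *
        (1 + (Fintype.card ι + Fintype.card κ) * D) +
      (Fintype.card ι * Fintype.card κ * 𝔼 a, 𝔼 b, e a b) ^ 2 := by
  set N : ℝ := ((Fintype.card ι : ℕ) : ℝ)
  set M : ℝ := ((Fintype.card κ : ℕ) : ℝ)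
  set p : ℝ := 𝔼 a, 𝔼 b, e a b with hp
  have hN : 0 ≤ N := Nat.cast_nonneg _
  have hM : 0 ≤ M := Nat.cast_nonneg _
  have hdeg0 (a : α) : 0 ≤ 𝔼 b, e a b :=
    Finset.expect_nonneg fun b _ => by rw [← he]; positivity
  have hcol (b : α) : 𝔼 a, e a b = 𝔼 a, e b a :=
    Finset.expect_congr rfl fun a _ => hsymm a b
  have hdegsq : 𝔼 a, (𝔼 b, e a b) ^ 2 ≤ D * p := by
    rw [hp, Finset.mul_expect]
    refine Finset.expect_le_expect fun a _ => ?_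
    rw [sq]
    exact mul_le_mul_of_nonneg_right (hD a) (hdeg0 a)
  have hone (a : α) : 𝔼 y : κ → α, (∑ j, e a (y j)) ^ 2 ≤
      M * (𝔼 b, e a b) + M ^ 2 * (𝔼 b, e a b) ^ 2 := by
    simpa only [he] using expect_sq_sum_apply_le (ι := κ) (fun b => e a b)
  have htwo (y : κ → α) : 𝔼 x : ι → α, (∑ i, ∑ j, e (x i) (y j)) ^ 2 ≤
      N * (𝔼 a, (∑ j, e a (y j)) ^ 2) + N ^ 2 * (∑ j, 𝔼 a, e (y j) a) ^ 2 := by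
    have h := expect_sq_sum_apply_le (ι := ι) (fun a => ∑ j, e a (y j))
    simpa only [Finset.expect_sum_comm, hcol] using h
  have hthree : 𝔼 y : κ → α, (∑ j, 𝔼 a, e (y j) a) ^ 2 ≤ M * (D * p) + M ^ 2 * p ^ 2 := by
    refine (expect_sq_sum_apply_le (ι := κ) (fun b => 𝔼 a, e b a)).trans ?_
    gcongr
  calc 𝔼 x : ι → α, 𝔼 y : κ → α, (∑ i, ∑ j, e (x i) (y j)) ^ 2
      = 𝔼 y : κ → α, 𝔼 x : ι → α, (∑ i, ∑ j, e (x i) (y j)) ^ 2 := Finset.expect_comm _ _ _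
    _ ≤ 𝔼 y : κ → α,
        (N * (𝔼 a, (∑ j, e a (y j)) ^ 2) + N ^ 2 * (∑ j, 𝔼 a, e (y j) a) ^ 2) :=
        Finset.expect_le_expect fun y _ => htwo y
    _ = N * (𝔼 a, 𝔼 y : κ → α, (∑ j, e a (y j)) ^ 2) +
        N ^ 2 * 𝔼 y : κ → α, (∑ j, 𝔼 a, e (y j) a) ^ 2 := by
        rw [Finset.expect_add_distrib, ← Finset.mul_expect, ← Finset.mul_expect,
          Finset.expect_comm]
    _ ≤ N * (𝔼 a, (M * (𝔼 b, e a b) + M ^ 2 * (𝔼 b, e a b) ^ 2)) +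
        N ^ 2 * (M * (D * p) + M ^ 2 * p ^ 2) := by
        gcongr with a
        exact hone a
    _ = N * (M * p + M ^ 2 * 𝔼 a, (𝔼 b, e a b) ^ 2) +
        N ^ 2 * (M * (D * p) + M ^ 2 * p ^ 2) := by
        rw [Finset.expect_add_distrib, ← Finset.mul_expect, ← Finset.mul_expect]
    _ ≤ N * (M * p + M ^ 2 * (D * p)) + N ^ 2 * (M * (D * p) + M ^ 2 * p ^ 2) := by
        gcongr
    _ = _ := by ring

theorem expect_edges [DecidableEq ι] [DecidableEq κ] [Nonempty α] (e : α → α → ℝ) :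
    𝔼 x : ι → α, 𝔼 y : κ → α, ∑ i, ∑ j, e (x i) (y j) =
      Fintype.card ι * Fintype.card κ * 𝔼 a, 𝔼 b, e a b := by
  have h (x : ι → α) : 𝔼 y : κ → α, ∑ i, ∑ j, e (x i) (y j) =
      ∑ i, Fintype.card κ * 𝔼 b, e (x i) b := by
    rw [Finset.expect_sum_comm]
    exact Finset.sum_congr rfl fun i _ => expect_sum_apply _
  simp only [h]
  rw [expect_sum_apply (fun a => Fintype.card κ * 𝔼 b, e a b), ← Finset.mul_expect]
  ring

open Classical in
/-- If two independent samples are rarely joined by an edge of `R`, then, after removing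
few vertices, the edge density of `R` is at most the inverse of the number of sampled pairs. -/
theorem exists_sparse_subset [DecidableEq ι] [DecidableEq κ] [Nonempty α] (R : α → α → Prop)
    (hR : ∀ a b, R a b → R b a) (hι : 0 < Fintype.card ι)
    (hικ : Fintype.card ι ≤ Fintype.card κ) {η : ℝ} (hη : η ≤ 1 / 4)
    (h : 𝔼 x : ι → α, 𝔼 y : κ → α, (if ∃ i j, R (x i) (y j) then (1 : ℝ) else 0) ≤ η) :
    ∃ B : α → Prop, 𝔼 a, (if B a then (1 : ℝ) else 0) ≤ 2 * η ∧
      (Fintype.card ι : ℝ) * Fintype.card κ *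
        (𝔼 a, 𝔼 b, if ¬ B a ∧ ¬ B b ∧ R a b then (1 : ℝ) else 0) ≤ 1 := by
  set N : ℝ := ((Fintype.card ι : ℕ) : ℝ)
  set M : ℝ := ((Fintype.card κ : ℕ) : ℝ)
  have hN : 0 < N := by simpa [N] using hι
  have hNM : N ≤ M := by simpa [N, M] using hικ
  have hM : 0 < M := hN.trans_le hNM
  let deg (a : α) : ℝ := 𝔼 b, if R a b then (1 : ℝ) else 0
  -- At degree `1 / M` a sample of size `M` expects one neighbour. Vertices above this threshold are
  -- seen too often to be numerous; below it, the second moment is under control.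
  refine ⟨fun a => 1 / M ≤ deg a, ?_, ?_⟩
  · obtain ⟨i⟩ : Nonempty ι := Fintype.card_pos_iff.mp hι
    have hmiss (a : α) (ha : 1 / M ≤ deg a) :
        1 / 2 ≤ 𝔼 y : κ → α, (if ∃ j, R a (y j) then (1 : ℝ) else 0) := by
      have hdeg1 : deg a ≤ 1 :=
        Finset.expect_le Finset.univ_nonempty fun b _ => by split_ifs <;> norm_num
      have hprod : 𝔼 y : κ → α, (1 - if ∃ j, R a (y j) then (1 : ℝ) else 0) =
          (1 - deg a) ^ Fintype.card κ := by
        have h0 := expect_pi_prod (fun (_ : κ) b => 1 - if R a b then (1 : ℝ) else 0)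
        simp only [Finset.expect_sub_distrib, Fintype.expect_const, Finset.prod_const,
          Finset.card_univ] at h0
        rw [← h0]
        refine Finset.expect_congr rfl fun y _ => ?_
        split_ifs with hy
        · obtain ⟨j, hj⟩ := hy
          rw [Finset.prod_eq_zero (Finset.mem_univ j)] <;> simp [hj]
        · push Not at hy
          simp [hy]
      have hexp : (1 - deg a) ^ Fintype.card κ ≤ Real.exp (-1) := by
        calc (1 - deg a) ^ Fintype.card κ ≤ Real.exp (-(1 / M)) ^ Fintype.card κ := by
              refine pow_le_pow_left₀ (by linarith) ?_ _
              linarith [Real.add_one_le_exp (-(1 / M))]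
          _ = Real.exp (-1) := by
              rw [← Real.exp_nat_mul]
              congr 1
              change M * -(1 / M) = -1
              field_simp
      have hhalf : Real.exp (-1) ≤ 1 / 2 := by
        rw [Real.exp_neg, inv_eq_one_div]
        exact one_div_le_one_div_of_le (by norm_num) (by linarith [Real.add_one_le_exp (1 : ℝ)])
      rw [Finset.expect_sub_distrib, Fintype.expect_const] at hprod
      linarith
    -- A single coordinate `i` of the first sample suffices here.
    have hlow : 𝔼 a, (if 1 / M ≤ deg a then (1 : ℝ) else 0) * (1 / 2) ≤ η := by
      rw [← expect_pi_apply (fun a => (if 1 / M ≤ deg a then (1 : ℝ) else 0) * (1 / 2)) i]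
      refine le_trans (Finset.expect_le_expect fun x _ => ?_) h
      split_ifs with hx
      · refine le_trans ?_ ((hmiss _ hx).trans (Finset.expect_le_expect fun y _ => ?_))
        · norm_num
        · split_ifs with h1 h2 h2
          · rfl
          · exact absurd ⟨i, h1⟩ h2
          · norm_num
          · rfl
      · rw [zero_mul]
        exact Finset.expect_nonneg fun y _ => by split_ifs <;> norm_num
    rw [← Finset.expect_mul] at hlow
    linarith
  · set e : α → α → ℝ := fun a b =>
      if ¬ 1 / M ≤ deg a ∧ ¬ 1 / M ≤ deg b ∧ R a b then (1 : ℝ) else 0 with he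
    have hesq (a b : α) : e a b ^ 2 = e a b := by simp only [he]; split_ifs <;> norm_num
    have hesymm (a b : α) : e a b = e b a := by
      have : (¬ 1 / M ≤ deg a ∧ ¬ 1 / M ≤ deg b ∧ R a b) ↔
          (¬ 1 / M ≤ deg b ∧ ¬ 1 / M ≤ deg a ∧ R b a) :=
        ⟨fun h => ⟨h.2.1, h.1, hR _ _ h.2.2⟩, fun h => ⟨h.2.1, h.1, hR _ _ h.2.2⟩⟩
      simp only [he, this]
    have hD (a : α) : 𝔼 b, e a b ≤ 1 / M := by
      by_cases ha : 1 / M ≤ deg a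
      · have : 𝔼 b, e a b = 0 := Finset.expect_eq_zero fun b _ => if_neg fun h => h.1 ha
        rw [this]; positivity
      · refine le_trans (Finset.expect_le_expect fun b _ => ?_) (not_le.mp ha).le
        simp only [he]
        split_ifs with h1 h2 h2
        · rfl
        · exact absurd h1.2.2 h2
        · norm_num
        · rfl
    set T : ℝ := N * M * 𝔼 a, 𝔼 b, e a b with hT
    have hT0 : 0 ≤ T := mul_nonneg (by positivity) (Finset.expect_nonneg fun a _ =>
      Finset.expect_nonneg fun b _ => by rw [← hesq]; positivity)
    have hsecond : 𝔼 x : ι → α, 𝔼 y : κ → α, (∑ i, ∑ j, e (x i) (y j)) ^ 2 ≤ 3 * T + T ^ 2 := by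
      refine (expect_sq_edges_le e hesq hesymm hD).trans ?_
      change T * (1 + (N + M) * (1 / M)) + T ^ 2 ≤ _
      have : (N + M) * (1 / M) ≤ 2 := by
        rw [mul_one_div, div_le_iff₀ hM]; linarith
      nlinarith
    -- For the edge count `X`, `(1 - t * X) ^ 2 ≥ 0` bounds the indicator of `X ≠ 0` below by `2 * t
    -- * X - t ^ 2 * X ^ 2`. The choice `t = 1 / (3 + T)` optimises this for mean `T` and second
    -- moment `3 * T + T ^ 2`.
    have hpoint : 2 / (3 + T) * T - (3 * T + T ^ 2) / (3 + T) ^ 2 ≤ η := by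
      calc 2 / (3 + T) * T - (3 * T + T ^ 2) / (3 + T) ^ 2
          ≤ 2 / (3 + T) * (𝔼 x : ι → α, 𝔼 y : κ → α, ∑ i, ∑ j, e (x i) (y j)) -
            (𝔼 x : ι → α, 𝔼 y : κ → α, (∑ i, ∑ j, e (x i) (y j)) ^ 2) / (3 + T) ^ 2 := by
            rw [expect_edges]
            gcongr
        _ = 𝔼 x : ι → α, 𝔼 y : κ → α, (2 / (3 + T) * (∑ i, ∑ j, e (x i) (y j)) -
              (∑ i, ∑ j, e (x i) (y j)) ^ 2 / (3 + T) ^ 2) := by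
            simp only [Finset.expect_sub_distrib, ← Finset.mul_expect, ← Finset.expect_div]
        _ ≤ 𝔼 x : ι → α, 𝔼 y : κ → α, (if ∃ i j, R (x i) (y j) then (1 : ℝ) else 0) := by
            refine Finset.expect_le_expect fun x _ => Finset.expect_le_expect fun y _ => ?_
            split_ifs with hxy
            · have := sq_nonneg (1 - (∑ i, ∑ j, e (x i) (y j)) / (3 + T))
              have h2 : (1 - (∑ i, ∑ j, e (x i) (y j)) / (3 + T)) ^ 2 =
                1 - (2 / (3 + T) * (∑ i, ∑ j, e (x i) (y j)) -
                  (∑ i, ∑ j, e (x i) (y j)) ^ 2 / (3 + T) ^ 2) := by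
                rw [sub_sq, div_pow]; ring
              linarith
            · have : ∑ i, ∑ j, e (x i) (y j) = 0 :=
                Finset.sum_eq_zero fun i _ => Finset.sum_eq_zero fun j _ =>
                  if_neg fun h => hxy ⟨i, j, h.2.2⟩
              simp [this]
        _ ≤ η := h
    have hsimp : 2 / (3 + T) * T - (3 * T + T ^ 2) / (3 + T) ^ 2 = T / (3 + T) := by
      field_simp; ring
    rw [hsimp, div_le_iff₀ (by positivity)] at hpoint
    nlinarith

end Sampling

/-! ### Sparse vectors in low dimension have many coherent pairs -/

section Coherence

open Classical in
/-- The part of the squared norm of a sparse vector carried by its large entries. -/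
theorem le_sum_sq_heavy {m : ℕ} {ε : ℝ} (hε : 0 < ε) (hε' : ε ≤ 1 / 100) (v : Fin m → ℝ)
    (hv : (1 - ε) ^ 2 ≤ ∑ r, v r ^ 2)
    (hs : ((Finset.univ.filter fun r => v r ≠ 0).card : ℝ) ≤ 1 / (9 * ε)) :
    1 / 12 ≤ ∑ r, if 8 * ε ≤ v r ^ 2 then v r ^ 2 else 0 := by
  have hle : ∑ r, v r ^ 2 ≤
      ∑ r, ((if 8 * ε ≤ v r ^ 2 then v r ^ 2 else 0) + if v r ≠ 0 then 8 * ε else 0) := by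
    refine Finset.sum_le_sum fun r _ => ?_
    split_ifs with h1 h2 h2
    · linarith
    · linarith
    · linarith
    · simp [not_not.mp h2]
  rw [Finset.sum_add_distrib, ← Finset.sum_filter (fun r => v r ≠ 0), Finset.sum_const,
    nsmul_eq_mul] at hle
  -- The light entries carry at most `8 / 9`, leaving `(1 - ε) ^ 2 - 8 / 9 ≥ 1 / 12`.
  have hlight : ((Finset.univ.filter fun r => v r ≠ 0).card : ℝ) * (8 * ε) ≤ 8 / 9 := by
    calc _ ≤ 1 / (9 * ε) * (8 * ε) := by gcongr
      _ = 8 / 9 := by field_simp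
  nlinarith

open Classical in
/-- Sparse vectors of norm close to one in dimension `m` cannot be pairwise incoherent: a pair
drawn at random is coherent with probability at least of order `1 / m`. -/
theorem coherent_pairs_lower_bound {α : Type*} [Fintype α] [Nonempty α] {m : ℕ} {ε : ℝ}
    (hε : 0 < ε) (hε' : ε ≤ 1 / 100) (v : α → Fin m → ℝ) (G : α → Prop)
    (hG : 1 / 2 ≤ 𝔼 a, if G a then (1 : ℝ) else 0)
    (hlow : ∀ a, G a → (1 - ε) ^ 2 ≤ ∑ r, v a r ^ 2)
    (hup : ∀ a, G a → ∑ r, v a r ^ 2 ≤ (1 + ε) ^ 2)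
    (hs : ∀ a, ((Finset.univ.filter fun r => v a r ≠ 0).card : ℝ) ≤ 1 / (9 * ε)) :
    1 / 1152 ≤ (m : ℝ) *
      𝔼 a, 𝔼 b, if G a ∧ G b ∧ 2 * ε < |v a ⬝ᵥ v b| then (1 : ℝ) else 0 := by
  set p : ℝ := 𝔼 a, 𝔼 b, if G a ∧ G b ∧ 2 * ε < |v a ⬝ᵥ v b| then (1 : ℝ) else 0 with hp
  -- Heavy part of `v a`. The kernel `W` weights pairs by the overlap of their heavy parts.
  let g (a : α) (r : Fin m) : ℝ := if G a ∧ 8 * ε ≤ v a r ^ 2 then v a r else 0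
  let q (r : Fin m) : ℝ := 𝔼 a, v a r * g a r
  let W (a b : α) : ℝ := g a ⬝ᵥ g b
  set S : ℝ := ∑ r, q r ^ 2 with hS
  have hmass : 1 / 24 ≤ ∑ r, q r := by
    simp only [q]
    rw [← Finset.expect_sum_comm]
    calc (1 : ℝ) / 24 ≤ 𝔼 a, (if G a then (1 : ℝ) else 0) * (1 / 12) := by
          rw [← Finset.expect_mul]; linarith
      _ ≤ _ := by
          refine Finset.expect_le_expect fun a _ => ?_
          by_cases ha : G a
          · have := le_sum_sq_heavy hε hε' (v a) (hlow a ha) (hs a)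
            simp only [ha, if_true, one_mul]
            refine this.trans (Finset.sum_le_sum fun r _ => ?_)
            simp only [g, ha, true_and]
            split_ifs
            · rw [sq]
            · simp
          · simp [ha, g]
  have hSm : (1 / 24) ^ 2 ≤ m * S := by
    calc ((1 : ℝ) / 24) ^ 2 ≤ (∑ r, q r) ^ 2 := by gcongr
      _ ≤ _ := by simpa using sq_sum_le_card_mul_sum_sq (s := Finset.univ) (f := q)
  -- The right side is the squared Frobenius norm of the averaged matrix `v a ⊗ g a`; `S` is the
  -- contribution of its diagonal.
  have hmain : S ≤ 𝔼 a, 𝔼 b, (v a ⬝ᵥ v b) * W a b := by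
    have hexpand : 𝔼 a, 𝔼 b, (v a ⬝ᵥ v b) * W a b =
        ∑ r, ∑ t, (𝔼 a, v a t * g a r) ^ 2 := by
      simp only [W, dotProduct, Finset.sum_mul_sum, sq, Finset.expect_mul_expect,
        ← Finset.expect_sum_comm]
      refine Finset.expect_congr rfl fun a _ => Finset.expect_congr rfl fun b _ => ?_
      rw [Finset.sum_comm]
      refine Finset.sum_congr rfl fun r _ => Finset.sum_congr rfl fun t _ => ?_
      ring
    rw [hexpand, hS]
    refine Finset.sum_le_sum fun r _ => ?_
    exact Finset.single_le_sum (f := fun t => (𝔼 a, v a t * g a r) ^ 2)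
      (fun t _ => sq_nonneg _) (Finset.mem_univ r)
  -- Incoherent pairs account for at most a quarter of `S`: a nonzero `g a r` is at least `√(8 * ε)`
  -- in absolute value, so `|g a r|` is at most `g a r ^ 2 / √(8 * ε)`.
  have habs : 2 * ε * (𝔼 a, 𝔼 b, |W a b|) ≤ S / 4 := by
    have hW : 𝔼 a, 𝔼 b, |W a b| ≤ ∑ r, (𝔼 a, |g a r|) ^ 2 := by
      simp only [sq, Finset.expect_mul_expect, ← Finset.expect_sum_comm, W, dotProduct]
      refine Finset.expect_le_expect fun a _ => Finset.expect_le_expect fun b _ => ?_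
      exact (Finset.abs_sum_le_sum_abs _ _).trans_eq
        (Finset.sum_congr rfl fun r _ => abs_mul _ _)
    have hg (a : α) (r : Fin m) : √(8 * ε) * |g a r| ≤ v a r * g a r := by
      simp only [g]
      split_ifs with h
      · rw [← sq, ← sq_abs, sq |v a r|]
        refine mul_le_mul_of_nonneg_right ?_ (abs_nonneg _)
        rw [← Real.sqrt_sq_eq_abs]
        exact Real.sqrt_le_sqrt h.2
      · simp
    have hq (r : Fin m) : 8 * ε * (𝔼 a, |g a r|) ^ 2 ≤ q r ^ 2 := by
      have h1 : √(8 * ε) * (𝔼 a, |g a r|) ≤ q r := by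
        rw [Finset.mul_expect]
        exact Finset.expect_le_expect fun a _ => hg a r
      have h2 : 0 ≤ 𝔼 a, |g a r| := Finset.expect_nonneg fun a _ => abs_nonneg _
      calc 8 * ε * (𝔼 a, |g a r|) ^ 2 = (√(8 * ε) * (𝔼 a, |g a r|)) ^ 2 := by
            rw [mul_pow, Real.sq_sqrt (by positivity)]
        _ ≤ _ := by gcongr
    have h8 : 8 * ε * ∑ r, (𝔼 a, |g a r|) ^ 2 ≤ S := by
      rw [Finset.mul_sum]
      exact Finset.sum_le_sum fun r _ => hq r
    nlinarith
  have hbound (a b : α) (ha : G a) (hb : G b) : (v a ⬝ᵥ v b) * W a b ≤ (1 + ε) ^ 2 * (1 + ε) ^ 2 := by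
    have hcs (f h : Fin m → ℝ) (hf : ∑ r, f r ^ 2 ≤ (1 + ε) ^ 2)
        (hh : ∑ r, h r ^ 2 ≤ (1 + ε) ^ 2) : |f ⬝ᵥ h| ≤ (1 + ε) ^ 2 := by
      refine abs_le_of_sq_le_sq ?_ (by positivity)
      calc (f ⬝ᵥ h) ^ 2 ≤ (∑ r, f r ^ 2) * ∑ r, h r ^ 2 :=
            Finset.sum_mul_sq_le_sq_mul_sq _ _ _
        _ ≤ (1 + ε) ^ 2 * (1 + ε) ^ 2 :=
            mul_le_mul hf hh (Finset.sum_nonneg fun r _ => sq_nonneg _) (by positivity)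
        _ = _ := (sq _).symm
    have hgsum (c : α) (hc : G c) : ∑ r, g c r ^ 2 ≤ (1 + ε) ^ 2 := by
      refine (Finset.sum_le_sum fun r _ => ?_).trans (hup c hc)
      simp only [g]
      split_ifs
      · rfl
      · simpa using sq_nonneg (v c r)
    calc (v a ⬝ᵥ v b) * W a b ≤ |v a ⬝ᵥ v b| * |W a b| := by
          rw [← abs_mul]; exact le_abs_self _
      _ ≤ _ := mul_le_mul (hcs _ _ (hup a ha) (hup b hb)) (hcs _ _ (hgsum a ha) (hgsum b hb))
          (abs_nonneg _) (by positivity)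
  have hsplit : 𝔼 a, 𝔼 b, (v a ⬝ᵥ v b) * W a b ≤
      2 * ε * (𝔼 a, 𝔼 b, |W a b|) + (1 + ε) ^ 2 * (1 + ε) ^ 2 * p := by
    rw [hp]
    simp only [Finset.mul_expect, ← Finset.expect_add_distrib]
    refine Finset.expect_le_expect fun a _ => Finset.expect_le_expect fun b _ => ?_
    by_cases ha : G a
    · by_cases hb : G b
      · simp only [ha, hb, true_and]
        split_ifs with h
        · have := hbound a b ha hb
          have := abs_nonneg (W a b)
          nlinarith
        · rw [mul_zero, add_zero]
          refine (le_abs_self _).trans ?_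
          rw [abs_mul]
          exact mul_le_mul_of_nonneg_right (not_lt.mp h) (abs_nonneg _)
      · have : W a b = 0 := by simp [W, g, hb, dotProduct]
        simp [this, hb]
    · have : W a b = 0 := by simp [W, g, ha, dotProduct]
      simp [this, ha]
  have hp0 : 0 ≤ p := Finset.expect_nonneg fun a _ => Finset.expect_nonneg fun b _ => by
    split_ifs <;> norm_num
  have hconst : (1 + ε) ^ 2 * (1 + ε) ^ 2 ≤ 3 / 2 := by
    calc (1 + ε) ^ 2 * (1 + ε) ^ 2 ≤ (1 + 1 / 100) ^ 2 * (1 + 1 / 100) ^ 2 := by gcongr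
      _ ≤ 3 / 2 := by norm_num
  have hSp : S ≤ 2 * p := by nlinarith
  have : (m : ℝ) * S ≤ m * (2 * p) := by gcongr
  linarith

end Coherence

/-! ### Consequences of embedding a sample of basis vectors -/

section Embedding

theorem l2norm_sq {k : ℕ} (v : Fin k → ℝ) : l2norm v ^ 2 = v ⬝ᵥ v := by
  rw [l2norm, EuclideanSpace.real_norm_sq_eq]
  simp [dotProduct, sq]

/-- Each basis vector selected by the first level of the hard distribution lies in the column
space. -/
theorem hard_mulVec_single {n d : ℕ} (c : Fin d × Fin 1 → Fin n) (σ : Fin d × Fin 1 → ℤˣ)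
    (i : Fin d × Fin 1) :
    (selMatrix c * signMatrix σ).mulVec (Pi.single i.1 (((σ i : ℤˣ) : ℤ) : ℝ)) =
      Pi.single (c i) 1 := by
  have hi (j : Fin d × Fin 1) : j.1 = i.1 ↔ j = i := by
    rw [Prod.ext_iff]; simp [Subsingleton.elim j.2 i.2]
  have hsign : (((σ i : ℤˣ) : ℤ) : ℝ) * (((σ i : ℤˣ) : ℤ) : ℝ) = 1 := by
    rw [← Int.cast_mul, ← Units.val_mul, Int.units_mul_self]; simp
  rw [← Matrix.mulVec_mulVec]
  have hsingle : (signMatrix σ).mulVec (Pi.single i.1 (((σ i : ℤˣ) : ℤ) : ℝ)) =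
      Pi.single i 1 := by
    ext j
    by_cases hj : j = i
    · subst hj; simp [signMatrix, hsign]
    · simp [signMatrix, hi, hj]
  rw [hsingle, Matrix.mulVec_single_one]
  ext r
  simp [selMatrix, Pi.single_apply]

theorem Embeds.sq_bounds {m n d : ℕ} {ε : ℝ} (hε : ε ≤ 1)
    {P : Matrix (Fin m) (Fin n) ℝ} {A : Matrix (Fin n) (Fin d) ℝ} (h : Embeds ε P A)
    {u : Fin n → ℝ} (hu : ∃ x, A.mulVec x = u) :
    (1 - ε) ^ 2 * (u ⬝ᵥ u) ≤ P.mulVec u ⬝ᵥ P.mulVec u ∧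
      P.mulVec u ⬝ᵥ P.mulVec u ≤ (1 + ε) ^ 2 * (u ⬝ᵥ u) := by
  obtain ⟨x, rfl⟩ := hu
  obtain ⟨h1, h2⟩ := h x
  rw [← Matrix.mulVec_mulVec] at h1 h2
  rw [← l2norm_sq, ← l2norm_sq, ← mul_pow, ← mul_pow]
  have h0 {k : ℕ} (v : Fin k → ℝ) : 0 ≤ l2norm v := norm_nonneg _
  exact ⟨pow_le_pow_left₀ (mul_nonneg (by linarith) (h0 _)) h1 2,
    pow_le_pow_left₀ (h0 _) h2 2⟩

/-- An embedding of a sample of basis vectors has columns of norm close to one at the sampled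
positions. -/
theorem Embeds.col_norm {m n d : ℕ} {ε : ℝ} (hε : ε ≤ 1)
    {P : Matrix (Fin m) (Fin n) ℝ} {c : Fin d × Fin 1 → Fin n} {σ : Fin d × Fin 1 → ℤˣ}
    (h : Embeds ε P (selMatrix c * signMatrix σ)) (i : Fin d × Fin 1) :
    (1 - ε) ^ 2 ≤ P.col (c i) ⬝ᵥ P.col (c i) ∧ P.col (c i) ⬝ᵥ P.col (c i) ≤ (1 + ε) ^ 2 := by
  simpa using h.sq_bounds hε ⟨_, hard_mulVec_single c σ i⟩

/-- An embedding of a sample of basis vectors has nearly orthogonal columns at the sampled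
positions. -/
theorem Embeds.col_incoherent {m n d : ℕ} {ε : ℝ} (hε : ε ≤ 1)
    {P : Matrix (Fin m) (Fin n) ℝ} {c : Fin d × Fin 1 → Fin n} {σ : Fin d × Fin 1 → ℤˣ}
    (h : Embeds ε P (selMatrix c * signMatrix σ)) {i j : Fin d × Fin 1} (hij : c i ≠ c j) :
    |P.col (c i) ⬝ᵥ P.col (c j)| ≤ 2 * ε := by
  -- Polarization: four times the inner product is the difference of the squared norms of the images
  -- of sum and difference, at most `2 * ((1 + ε) ^ 2 - (1 - ε) ^ 2) = 8 * ε`.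
  have hadd := h.sq_bounds hε (u := Pi.single (c i) 1 + Pi.single (c j) 1)
    ⟨_, (Matrix.mulVec_add _ _ _).trans
      (congrArg₂ _ (hard_mulVec_single c σ i) (hard_mulVec_single c σ j))⟩
  have hsub := h.sq_bounds hε (u := Pi.single (c i) 1 - Pi.single (c j) 1)
    ⟨_, (Matrix.mulVec_sub _ _ _).trans
      (congrArg₂ _ (hard_mulVec_single c σ i) (hard_mulVec_single c σ j))⟩
  have hadd2 : (Pi.single (c i) 1 + Pi.single (c j) 1 : Fin n → ℝ) ⬝ᵥ
      (Pi.single (c i) 1 + Pi.single (c j) 1) = 2 := by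
    simp [hij, hij.symm]; norm_num
  have hsub2 : (Pi.single (c i) 1 - Pi.single (c j) 1 : Fin n → ℝ) ⬝ᵥ
      (Pi.single (c i) 1 - Pi.single (c j) 1) = 2 := by
    simp [hij, hij.symm]; norm_num
  rw [hadd2, Matrix.mulVec_add, Matrix.mulVec_single_one, Matrix.mulVec_single_one] at hadd
  rw [hsub2, Matrix.mulVec_sub, Matrix.mulVec_single_one, Matrix.mulVec_single_one] at hsub
  simp only [add_dotProduct, dotProduct_add, sub_dotProduct, dotProduct_sub] at hadd hsub
  have hcomm := dotProduct_comm (P.col (c i)) (P.col (c j))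
  rw [abs_le]
  constructor <;> nlinarith

end Embedding

/-! ### From the hard distribution to the row bound -/

section Distribution

theorem toOuterMeasure_uniformOfFintype {Ω : Type*} [Fintype Ω] [Nonempty Ω] (E : Ω → Prop)
    [DecidablePred E] :
    (PMF.uniformOfFintype Ω).toOuterMeasure {ω | E ω} =
      ENNReal.ofReal (𝔼 ω, if E ω then (1 : ℝ) else 0) := by
  rw [PMF.toOuterMeasure_uniformOfFintype_apply, Fintype.expect_eq_sum_div_card,
    ENNReal.ofReal_div_of_pos (by exact_mod_cast Fintype.card_pos)]
  simp [Fintype.card_subtype]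

theorem toOuterMeasure_le_one {Ω : Type*} (D : PMF Ω) (T : Set Ω) : D.toOuterMeasure T ≤ 1 := by
  rw [← (D.toOuterMeasure_apply_eq_one_iff Set.univ).mpr (Set.subset_univ _)]
  exact MeasureTheory.measure_mono (Set.subset_univ _)

/-- As `Q` sees only the positions, the signs average out. -/
theorem hardDist_toOuterMeasure_le {m n d : ℕ} [NeZero n] {ε : ℝ} {P : Matrix (Fin m) (Fin n) ℝ}
    (Q : (Fin d × Fin 1 → Fin n) → Prop) [DecidablePred Q]
    (hQ : ∀ c σ, Embeds ε P (selMatrix c * signMatrix σ) → Q c) :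
    (hardDist n d 1).toOuterMeasure {A | Embeds ε P A} ≤
      ENNReal.ofReal (𝔼 c, if Q c then (1 : ℝ) else 0) := by
  have hprod : 𝔼 ω : (Fin d × Fin 1 → Fin n) × (Fin d × Fin 1 → ℤˣ),
      (if Q ω.1 then (1 : ℝ) else 0) = 𝔼 c, if Q c then (1 : ℝ) else 0 := by
    rw [← Finset.univ_product_univ, Finset.expect_product]
    refine Finset.expect_congr rfl fun c _ => ?_
    exact Finset.expect_const (Finset.univ_nonempty (α := Fin d × Fin 1 → ℤˣ))
      (if Q c then (1 : ℝ) else 0)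
  rw [hardDist, PMF.toOuterMeasure_map_apply, ← hprod, ← toOuterMeasure_uniformOfFintype]
  exact MeasureTheory.measure_mono fun ω hω => hQ _ _ hω

/-- An event on the sampled positions that excludes the embedding property has probability at
most `2 δ`, because the mixed distribution is `D_1` with probability `1 / 2`. -/
theorem IsSubspaceEmbedding.expect_le {m n d : ℕ} [NeZero n] {ε δ : ℝ}
    {P : Matrix (Fin m) (Fin n) ℝ} (h : IsSubspaceEmbedding ε δ P (mixedDist ε n d))
    (E : (Fin d × Fin 1 → Fin n) → Prop) [DecidablePred E]
    (hE : ∀ c σ, E c → ¬ Embeds ε P (selMatrix c * signMatrix σ)) :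
    𝔼 c, (if E c then (1 : ℝ) else 0) ≤ 2 * δ := by
  have hhard := hardDist_toOuterMeasure_le (ε := ε) (P := P) (fun c => ¬ E c)
    fun c σ hc hEc => hE c σ hEc hc
  have hcompl : 𝔼 c, (if ¬ E c then (1 : ℝ) else 0) = 1 - 𝔼 c, if E c then (1 : ℝ) else 0 := by
    rw [← Fintype.expect_const (ι := Fin d × Fin 1 → Fin n) (1 : ℝ),
      ← Finset.expect_sub_distrib]
    refine Finset.expect_congr rfl fun c _ => ?_
    by_cases hc : E c <;> simp [hc]
  have hle1 : 𝔼 c, (if E c then (1 : ℝ) else 0) ≤ 1 :=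
    Finset.expect_le Finset.univ_nonempty fun c _ => by split_ifs <;> norm_num
  rw [hcompl] at hhard
  generalize 𝔼 c, (if E c then (1 : ℝ) else 0) = q at hhard hle1 ⊢
  have hmix : (mixedDist ε n d).toOuterMeasure {A | Embeds ε P A} ≤
      2⁻¹ * ENNReal.ofReal (1 - q) + 2⁻¹ * 1 := by
    rw [mixedDist, PMF.toOuterMeasure_bind_apply, tsum_fintype, Fintype.sum_bool,
      PMF.uniformOfFintype_apply, PMF.uniformOfFintype_apply, Fintype.card_bool, Nat.cast_ofNat]
    exact add_le_add (mul_le_mul_right hhard _) (mul_le_mul_right (toOuterMeasure_le_one _ _) _)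
  have hreal : (2⁻¹ : ENNReal) * ENNReal.ofReal (1 - q) + 2⁻¹ * 1 =
      ENNReal.ofReal ((1 - q) / 2 + 1 / 2) := by
    rw [ENNReal.ofReal_add (by linarith) (by norm_num),
      ENNReal.ofReal_div_of_pos (by norm_num), ENNReal.ofReal_div_of_pos (by norm_num)]
    simp [div_eq_mul_inv, mul_comm]
  have hle := h.trans hmix
  rw [hreal, ENNReal.ofReal_le_ofReal_iff (by linarith)] at hle
  linarith

theorem expect_pi_subtype {ι α : Type*} [Fintype ι] [DecidableEq ι] [Fintype α] (p : ι → Prop)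
    [DecidablePred p] (F : ({i // p i} → α) → ({i // ¬ p i} → α) → ℝ) :
    𝔼 x, 𝔼 y, F x y = 𝔼 c : ι → α, F (fun i => c i) (fun i => c i) := by
  rw [Fintype.expect_equiv (Equiv.piEquivPiSubtypeProd p fun _ => α)
    (fun c => F (fun i => c i) (fun i => c i)) (fun xy => F xy.1 xy.2) fun c => rfl,
    ← Finset.univ_product_univ, Finset.expect_product]

theorem card_first_indices (d k : ℕ) (hk : k ≤ d) :
    Fintype.card {i : Fin d × Fin 1 // (i.1 : ℕ) < k} = k := by
  rw [Fintype.card_congr ((Equiv.prodUnique (Fin d) (Fin 1)).subtypeEquiv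
    (p := fun i => (i.1 : ℕ) < k) (q := fun i : Fin d => (i : ℕ) < k) fun i => Iff.rfl),
    Fintype.card_subtype, Fin.card_filter_val_lt]
  omega

theorem IsSubspaceEmbedding.expect_col_norm_le {m n d : ℕ} [NeZero n] {ε δ : ℝ} (hε : ε ≤ 1)
    (hd : 0 < d) {P : Matrix (Fin m) (Fin n) ℝ}
    (h : IsSubspaceEmbedding ε δ P (mixedDist ε n d)) (good : Fin n → Prop) [DecidablePred good]
    (hgood : ∀ a, (1 - ε) ^ 2 ≤ P.col a ⬝ᵥ P.col a → P.col a ⬝ᵥ P.col a ≤ (1 + ε) ^ 2 → good a) :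
    𝔼 a, (if good a then (0 : ℝ) else 1) ≤ 2 * δ := by
  rw [← expect_pi_apply (fun a => if good a then (0 : ℝ) else 1) ((⟨0, hd⟩, 0) : Fin d × Fin 1)]
  have := h.expect_le (fun c => ¬ good (c (⟨0, hd⟩, 0)))
    fun c σ hc hemb => hc (hgood _ (hemb.col_norm hε _).1 (hemb.col_norm hε _).2)
  simpa only [ite_not] using this

open Classical in
/-- Outside a small set of columns of a subspace embedding, a random pair of distinct columns
is coherent with probability at most of order `1 / d ^ 2`. -/
theorem IsSubspaceEmbedding.exists_incoherent_subset {m n d : ℕ} [NeZero n] {ε δ : ℝ}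
    (hε : ε ≤ 1) (hδ : δ ≤ 1 / 8) (hd : 5 ≤ d) {P : Matrix (Fin m) (Fin n) ℝ}
    (h : IsSubspaceEmbedding ε δ P (mixedDist ε n d)) :
    ∃ B : Fin n → Prop, 𝔼 a, (if B a then (1 : ℝ) else 0) ≤ 4 * δ ∧
      (d : ℝ) ^ 2 * (𝔼 a, 𝔼 b, if ¬ B a ∧ ¬ B b ∧ a ≠ b ∧ 2 * ε < |P.col a ⬝ᵥ P.col b|
        then (1 : ℝ) else 0) ≤ 5 := by
  obtain ⟨R, hR⟩ : ∃ R : Fin n → Fin n → Prop,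
      ∀ a b, R a b ↔ a ≠ b ∧ 2 * ε < |P.col a ⬝ᵥ P.col b| := ⟨_, fun a b => Iff.rfl⟩
  have hRsymm (a b : Fin n) (hab : R a b) : R b a := by
    rw [hR] at hab ⊢
    exact ⟨hab.1.symm, by rw [dotProduct_comm]; exact hab.2⟩
  -- The two halves of the `d` positions act as independent samples.
  have hedge : 𝔼 x : {i : Fin d × Fin 1 // (i.1 : ℕ) < d / 2} → Fin n,
      𝔼 y : {i : Fin d × Fin 1 // ¬ (i.1 : ℕ) < d / 2} → Fin n,
      (if ∃ i j, R (x i) (y j) then (1 : ℝ) else 0) ≤ 2 * δ := by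
    rw [expect_pi_subtype (fun i : Fin d × Fin 1 => (i.1 : ℕ) < d / 2)
      (fun x y => if ∃ i j, R (x i) (y j) then (1 : ℝ) else 0)]
    refine h.expect_le _ fun c σ ⟨i, j, hij⟩ hemb => ?_
    rw [hR] at hij
    exact absurd hij.2 (not_lt.mpr (hemb.col_incoherent hε hij.1))
  have hcard := card_first_indices d (d / 2) (by omega)
  have hcard' : Fintype.card {i : Fin d × Fin 1 // ¬ (i.1 : ℕ) < d / 2} = d - d / 2 := by
    rw [Fintype.card_subtype_compl, hcard]; simp
  obtain ⟨B, hB, hpairs⟩ := exists_sparse_subset R hRsymm (by omega) (by omega)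
    (by linarith : 2 * δ ≤ 1 / 4) hedge
  refine ⟨B, by linarith, ?_⟩
  rw [hcard, hcard'] at hpairs
  simp only [← hR]
  have hp0 : 0 ≤ 𝔼 a, 𝔼 b, if ¬ B a ∧ ¬ B b ∧ R a b then (1 : ℝ) else 0 :=
    Finset.expect_nonneg fun a _ => Finset.expect_nonneg fun b _ => by split_ifs <;> norm_num
  generalize 𝔼 a, 𝔼 b, (if ¬ B a ∧ ¬ B b ∧ R a b then (1 : ℝ) else 0) = p at hpairs hp0 ⊢
  have hhalves : (d : ℝ) ^ 2 ≤ 5 * ((d / 2 : ℕ) * ((d - d / 2 : ℕ) : ℝ)) := by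
    obtain ⟨k, hk | hk⟩ := Nat.even_or_odd' d
    · have h1 : d / 2 = k := by omega
      have h2 : d - d / 2 = k := by omega
      rw [h2, h1, hk]; push_cast; nlinarith
    · have h1 : d / 2 = k := by omega
      have h2 : d - d / 2 = k + 1 := by omega
      have h3 : (2 : ℝ) ≤ k := by exact_mod_cast (by omega : 2 ≤ k)
      rw [h2, h1, hk]; push_cast; nlinarith
  calc (d : ℝ) ^ 2 * p ≤ 5 * ((d / 2 : ℕ) * ((d - d / 2 : ℕ) : ℝ)) * p := by gcongr
    _ ≤ 5 := by linarith

open Classical in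
/-- A sparse subspace embedding for the mixed distribution has at least of order `d ^ 2` rows. -/
theorem IsSubspaceEmbedding.sq_le_rows {m n d : ℕ} [NeZero n] {ε δ : ℝ} (hε : 0 < ε)
    (hε' : ε ≤ 1 / 100) (hδ' : δ ≤ 1 / 12) (hd : 5 ≤ d) (hn : (d : ℝ) ^ 2 ≤ n)
    {P : Matrix (Fin m) (Fin n) ℝ} (hs : (colSparsity P : ℝ) ≤ 1 / (9 * ε))
    (h : IsSubspaceEmbedding ε δ P (mixedDist ε n d)) :
    (d : ℝ) ^ 2 ≤ 6912 * m := by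
  obtain ⟨good, hgood⟩ : ∃ good : Fin n → Prop, ∀ a, good a ↔
      (1 - ε) ^ 2 ≤ P.col a ⬝ᵥ P.col a ∧ P.col a ⬝ᵥ P.col a ≤ (1 + ε) ^ 2 :=
    ⟨_, fun a => Iff.rfl⟩
  have hnorm := h.expect_col_norm_le (by linarith) (by omega) good
    fun a h1 h2 => (hgood a).mpr ⟨h1, h2⟩
  obtain ⟨B, hB, hpairs⟩ := h.exists_incoherent_subset (by linarith) (by linarith) hd
  obtain ⟨G, hGiff⟩ : ∃ G : Fin n → Prop, ∀ a, G a ↔ good a ∧ ¬ B a := ⟨_, fun a => Iff.rfl⟩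
  -- Losses of `2 * δ` (bad norm) and `4 * δ` (the set `B`); this is where `δ ≤ 1 / 12` is used in
  -- full.
  have hG : 1 / 2 ≤ 𝔼 a, if G a then (1 : ℝ) else 0 := by
    have : 𝔼 a, (1 - (if good a then (0 : ℝ) else 1) - if B a then (1 : ℝ) else 0) ≤
        𝔼 a, if G a then (1 : ℝ) else 0 := by
      refine Finset.expect_le_expect fun a _ => ?_
      by_cases h1 : good a <;> by_cases h2 : B a <;> simp [hGiff, h1, h2]
    rw [Finset.expect_sub_distrib, Finset.expect_sub_distrib, Fintype.expect_const] at this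
    linarith
  have hsq (a : Fin n) : ∑ r, P.col a r ^ 2 = P.col a ⬝ᵥ P.col a := by
    simp [dotProduct, sq]
  have hsparse (a : Fin n) :
      ((Finset.univ.filter fun r => P.col a r ≠ 0).card : ℝ) ≤ 1 / (9 * ε) := by
    refine le_trans (Nat.cast_le.mpr ?_) hs
    exact Finset.le_sup (f := fun j : Fin n =>
        (Finset.univ.filter fun i : Fin m => P i j ≠ 0).card) (Finset.mem_univ a)
  have hcoh := coherent_pairs_lower_bound hε hε' (fun a => P.col a) G hG
    (fun a ha => by rw [hsq]; exact ((hgood a).mp ((hGiff a).mp ha).1).1)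
    (fun a ha => by rw [hsq]; exact ((hgood a).mp ((hGiff a).mp ha).1).2) hsparse
  -- Pairs with `a = b` are coherent for a trivial reason; their density `1 / n` is harmless because
  -- `n ≥ d ^ 2`.
  have hdiag : 𝔼 a, 𝔼 b, (if G a ∧ G b ∧ 2 * ε < |P.col a ⬝ᵥ P.col b| then (1 : ℝ) else 0) ≤
      (𝔼 a, 𝔼 b, if ¬ B a ∧ ¬ B b ∧ a ≠ b ∧ 2 * ε < |P.col a ⬝ᵥ P.col b|
        then (1 : ℝ) else 0) + 1 / n := by
    have : 𝔼 a : Fin n, 𝔼 b, (if a = b then (1 : ℝ) else 0) = 1 / n := by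
      simp
    rw [← this, ← Finset.expect_add_distrib]
    simp only [← Finset.expect_add_distrib]
    refine Finset.expect_le_expect fun a _ => Finset.expect_le_expect fun b _ => ?_
    by_cases hab : a = b
    · simp only [hab, if_true]
      split_ifs <;> norm_num
    · rw [if_neg hab, add_zero]
      split_ifs with h1 h2 h2
      · rfl
      · exact absurd ⟨((hGiff a).mp h1.1).2, ((hGiff b).mp h1.2.1).2, hab, h1.2.2⟩ h2
      · norm_num
      · rfl
  have hn0 : (0 : ℝ) < n := by exact_mod_cast Nat.pos_of_ne_zero (NeZero.ne n)
  generalize (𝔼 a, 𝔼 b, if ¬ B a ∧ ¬ B b ∧ a ≠ b ∧ 2 * ε < |P.col a ⬝ᵥ P.col b|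
    then (1 : ℝ) else 0) = p at hpairs hdiag
  generalize (𝔼 a, 𝔼 b, if G a ∧ G b ∧ 2 * ε < |P.col a ⬝ᵥ P.col b| then (1 : ℝ) else 0) = q at hcoh hdiag
  have hdq : (d : ℝ) ^ 2 * q ≤ 6 := by
    have h2 : (d : ℝ) ^ 2 * (1 / n) ≤ 1 := by
      rw [mul_one_div, div_le_one hn0]; exact hn
    calc (d : ℝ) ^ 2 * q ≤ (d : ℝ) ^ 2 * (p + 1 / n) := by gcongr
      _ ≤ 6 := by linarith
  have h1 := mul_le_mul_of_nonneg_left hcoh (sq_nonneg (d : ℝ))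
  have h2 := mul_le_mul_of_nonneg_left hdq (Nat.cast_nonneg (α := ℝ) m)
  linarith

end Distribution

end SparseEmbedding

theorem mainTheorem3 :
    ∃ ε₀ δ₀ c₀ K₀ K₁ : ℝ,
      0 < ε₀ ∧ ε₀ ≤ 1 / 16 ∧ 0 < δ₀ ∧ 0 < c₀ ∧ 0 < K₀ ∧ 0 < K₁ ∧
      ∀ (ε δ : ℝ), 0 < ε → ε < ε₀ → 0 < δ → δ < δ₀ →
      ∀ (m n d : ℕ) [NeZero n],
        1 / ε ^ 2 ≤ (d : ℝ) →
        K₀ * (d : ℝ) ^ 2 / (ε ^ 2 * δ) ≤ (n : ℝ) →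
        ∀ P : Matrix (Fin m) (Fin n) ℝ,
          (SparseEmbedding.colSparsity P : ℝ) ≤ 1 / (9 * ε) →
          SparseEmbedding.IsSubspaceEmbedding ε δ P (SparseEmbedding.mixedDist ε n d) →
          c₀ * (Real.logb 2 (1 / ε) ^ 4)⁻¹ * ε ^ (K₁ * δ) * (d : ℝ) ^ 2 < (m : ℝ) := by
  -- Taking `7000 > 6912` yields the strict inequality; the logarithmic factor and the power of `ε`
  -- are both at most one.
  refine ⟨1 / 100, 1 / 12, 1 / 7000, 1, 1, by norm_num, by norm_num, by norm_num, by norm_num,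
    by norm_num, by norm_num, ?_⟩
  intro ε δ hε hε' hδ hδ' m n d _ hd hn P hs hP
  have hinv : 100 ≤ 1 / ε := by
    rw [le_div_iff₀ hε]; linarith
  have hd5 : (5 : ℝ) ≤ d := by
    refine le_trans ?_ hd
    rw [← one_div_pow]
    nlinarith
  have hden : ε ^ 2 * δ ≤ 1 := by
    have : ε ^ 2 ≤ 1 := by nlinarith
    nlinarith
  have hn' : (d : ℝ) ^ 2 ≤ n := by
    refine le_trans ?_ hn
    rw [one_mul, le_div_iff₀ (by positivity)]
    nlinarith [sq_nonneg (d : ℝ)]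
  have hrows := hP.sq_le_rows hε hε'.le hδ'.le (by exact_mod_cast hd5) hn' hs
  have hlog : 1 ≤ Real.logb 2 (1 / ε) := by
    rw [Real.le_logb_iff_rpow_le (by norm_num) (by positivity), Real.rpow_one]
    linarith
  have hloginv : (Real.logb 2 (1 / ε) ^ 4)⁻¹ ≤ 1 := inv_le_one_of_one_le₀ (one_le_pow₀ hlog)
  have hpow : ε ^ (1 * δ) ≤ 1 := Real.rpow_le_one hε.le (by linarith) (by linarith)
  have hd2 : (0 : ℝ) < (d : ℝ) ^ 2 := by positivity
  calc (1 / 7000 : ℝ) * (Real.logb 2 (1 / ε) ^ 4)⁻¹ * ε ^ (1 * δ) * (d : ℝ) ^ 2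
      ≤ 1 / 7000 * 1 * 1 * (d : ℝ) ^ 2 := by gcongr
    _ < (m : ℝ) := by linarith
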